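/- Write $\dim(Y)\in\{0,1,2,\dots\}\cup\{\infty\}$ for the topological covering dimension of a nonempty space $Y$, and $\dim_{\mathrm{nuc}}(A)\in\{0,1,2,\dots\}\cup\{\infty\}$ for the nuclear dimension of a $C^*$-algebra $A$ (in the sense of Winter and Zacharias), and put $\dim^{+1}_{\mathrm{nuc}}(A)=\dim_{\mathrm{nuc}}(A)+1$. A $C^*$-algebra is called subhomogeneous if there is a finite bound on the dimensions of the Hilbert spaces of its irreducible representations. For a commutative unital $C^*$-algebra $M$, let $\widehat M$ be its Gelfand spectrum (the space of characters). **Proposition.** Let $A$ be a non-unital $C^*$-algebra with multiplier algebra $M(A)$, let $X\subset A$ be a subset whose linear span is dense in $A$, and let $M$ be a commutative $C^*$-subalgebra of $M(A)$ containing the unit of $M(A)$. Let $d,n\in\{0,1,2,\dots\}$. Suppose that for every finite $\mathcal F\subset X$ and every $\epsilon>0$ there exist $C^*$-subalgebras $B_0,\dots,B_d$ of $A$ and $b_0,\dots,b_d\in M$ such that $$\sum_{i=0}^d b_ib_i^*=1,$$ and such that $\dim_{\mathrm{nuc}}(B_i)\le n$ and $b_i\mathcal F b_i^*\subset B_i$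 for $0\le i\le d$, and $$\Big\|x-\sum_{i=0}^d b_ixb_i^*\Big\|<\epsilon\quad\text{for all }x\in\mathcal F .$$ Then $$\dim^{+1}_{\mathrm{nuc}}(A)\le (d+1)\big(\dim(\widehat M)+n+2\big).$$ If, moreover, the $C^*$-subalgebras $B_0,\dots,B_d$ can always be chosen separable and subhomogeneous, then $$\dim^{+1}_{\mathrm{nuc}}(A)\le (d+1)\big(\max\{n,\dim(\widehat M)\}+1\big).$$ -/

import Mathlib

open scoped MultiplierAlgebra CStarAlgebra

universe u

section NuclearDimension

attribute [local instance] CStarAlgebra.spectralOrder CStarAlgebra.spectralOrderedRing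

/-- A map between C*-algebras has *order zero* if it sends orthogonal positive elements to
orthogonal elements (it is applied to completely positive maps only). The order is the one of the
C*-algebra: `0 ≤ a` iff `a` is self-adjoint with spectrum in `[0, ∞)`. -/
def IsOrderZero {F A : Type*} [NonUnitalCStarAlgebra F] [NonUnitalCStarAlgebra A]
    (φ : F → A) : Prop :=
  ∀ x y : F, 0 ≤ x → 0 ≤ y → x * y = 0 → φ x * φ y = 0

/-- The nuclear dimension of the C*-algebra `A` is at most `d`: the identity of `A` can be
approximated on finite sets by completely positive maps `A → F → A` through a finite-dimensional
C*-algebra `F = F 0 ⊕ ⋯ ⊕ F d` (with the maximum norm), the first map being contractive and the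
second one being contractive and of order zero on each summand. Finite-dimensional C*-algebras
are unital, and, up to isomorphism, all of them live in `Type`; summands may be zero. -/
def NuclearDimLE (A : Type*) [NonUnitalCStarAlgebra A] (d : ℕ) : Prop :=
  ∀ (𝓕 : Finset A) (ε : ℝ), 0 < ε →
    ∃ (F : Fin (d + 1) → Type) (_ : ∀ i, CStarAlgebra (F i)) (_ : ∀ i, FiniteDimensional ℂ (F i))
      (ψ : A →CP (∀ i, F i)) (φ : (∀ i, F i) →CP A),
      (∀ a, ‖ψ a‖ ≤ ‖a‖) ∧
      (∀ i, (∀ x : F i, ‖φ (Pi.single i x)‖ ≤ ‖x‖) ∧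
        IsOrderZero fun x : F i => φ (Pi.single i x)) ∧
      ∀ a ∈ 𝓕, ‖φ (ψ a) - a‖ < ε

end NuclearDimension

/-- The nuclear dimension of a C*-algebra, `⊤` if it is infinite. -/
noncomputable def nuclearDim (A : Type*) [NonUnitalCStarAlgebra A] : ℕ∞ :=
  sInf {x : ℕ∞ | ∃ d : ℕ, x = d ∧ NuclearDimLE A d}

/-- The topological covering dimension of `X` is at most `N`: every open cover of `X` has an open
refinement such that each point of `X` lies in at most `N + 1` of its members. -/
def CoveringDimLE (X : Type*) [TopologicalSpace X] (N : ℕ) : Prop :=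
  ∀ 𝒰 : Set (Set X), (∀ U ∈ 𝒰, IsOpen U) → ⋃₀ 𝒰 = Set.univ →
    ∃ 𝒱 : Set (Set X), (∀ V ∈ 𝒱, IsOpen V) ∧ ⋃₀ 𝒱 = Set.univ ∧
      (∀ V ∈ 𝒱, ∃ U ∈ 𝒰, V ⊆ U) ∧
      ∀ x : X, {V | V ∈ 𝒱 ∧ x ∈ V}.encard ≤ ((N + 1 : ℕ) : ℕ∞)

/-- The topological covering dimension of a nonempty space, `⊤` if it is infinite. (The spaces
that occur below are spectra of nonzero unital C*-algebras, hence nonempty; for the empty space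
the value is `0`.) -/
noncomputable def coveringDim (X : Type*) [TopologicalSpace X] : ℕ∞ :=
  sInf {x : ℕ∞ | ∃ N : ℕ, x = N ∧ CoveringDimLE X N}

/-- A representation of a C*-algebra on a Hilbert space is *irreducible* if it is nonzero and has
no closed invariant subspaces other than `0` and the whole space. -/
def IsIrreducibleRep {B H : Type*} [NonUnitalCStarAlgebra B] [NormedAddCommGroup H]
    [InnerProductSpace ℂ H] [CompleteSpace H] (π : B →⋆ₙₐ[ℂ] (H →L[ℂ] H)) : Prop :=
  π ≠ 0 ∧ ∀ K : Submodule ℂ H, IsClosed (K : Set H) → (∀ b : B, ∀ x ∈ K, π b x ∈ K) →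
    K = ⊥ ∨ K = ⊤

/-- A C*-algebra is *subhomogeneous* if there is a bound `N : ℕ` on the dimensions of the Hilbert
spaces of its irreducible representations. (Every irreducible representation of `B : Type u` is
unitarily equivalent to one on a Hilbert space in `Type u`, by the GNS construction.) -/
def IsSubhomogeneous (B : Type u) [NonUnitalCStarAlgebra B] : Prop :=
  ∃ N : ℕ, ∀ (H : Type u) (_ : NormedAddCommGroup H) (_ : InnerProductSpace ℂ H)
    (_ : CompleteSpace H) (π : B →⋆ₙₐ[ℂ] (H →L[ℂ] H)), IsIrreducibleRep π →
      Module.rank ℂ H ≤ (N : Cardinal)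

/-- For a multiplier `b` and `x : A`, the element `b x b*` of `A`. -/
noncomputable def compress {A : Type*} [NonUnitalCStarAlgebra A] (b : 𝓜(ℂ, A)) (x : A) : A :=
  (star b).snd (b.fst x)

/-- A left multiplier commutes with right multiplications. -/
theorem multiplier_fst_mul {A : Type*} [NonUnitalCStarAlgebra A] (b : 𝓜(ℂ, A)) (x y : A) :
    b.fst (x * y) = b.fst x * y := by
  have h : ∀ z : A, z * (b.fst (x * y) - b.fst x * y) = 0 := fun z => by
    rw [mul_sub, ← b.central, ← mul_assoc z, ← b.central, mul_assoc, sub_self]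
  exact sub_eq_zero.1 ((CStarRing.star_mul_self_eq_zero_iff _).1 (h _))

/-- A right multiplier commutes with left multiplications. -/
theorem multiplier_snd_mul {A : Type*} [NonUnitalCStarAlgebra A] (b : 𝓜(ℂ, A)) (x y : A) :
    b.snd (x * y) = x * b.snd y := by
  have h : ∀ z : A, (b.snd (x * y) - x * b.snd y) * z = 0 := fun z => by
    rw [sub_mul, b.central, mul_assoc x (b.snd y), b.central, mul_assoc, sub_self]
  exact sub_eq_zero.1 ((CStarRing.mul_star_self_eq_zero_iff _).1 (h _))

/-- `compress b x` is the product `b * x * star b` in the multiplier algebra. -/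
theorem coe_compress {A : Type*} [NonUnitalCStarAlgebra A] (b : 𝓜(ℂ, A)) (x : A) :
    ((compress b x : A) : 𝓜(ℂ, A)) = b * (x : 𝓜(ℂ, A)) * star b := by
  apply DoubleCentralizer.ext
  refine Prod.ext ?_ ?_
  · ext y
    change (star b).snd (b.fst x) * y = b.fst (x * (star b).fst y)
    rw [(star b).central, multiplier_fst_mul]
  · ext y
    change y * (star b).snd (b.fst x) = (star b).snd (b.snd y * x)
    rw [b.central, multiplier_snd_mul]

/-!
The inequality `nuclearDim A + 1 ≤ (d + 1) * (n + 1)` holds under the hypotheses of either part, and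
its right-hand side is at most both bounds of the theorem (`nuclearDim_add_one_le`). Neither the
covering dimension of the spectrum of `M` nor subhomogeneity enters.

Given `𝓕`, take `B i` and `b i` as in the hypothesis. The compressions `x ↦ b i * x * star (b i)` are
completely positive contractions of `A` which map `𝓕` into `B i` and whose sum is close to the
identity on `𝓕`. On `B i` the identity is approximated by completely positive maps
`B i → F i → B i`. Composing the compression with `B i → F i` directly is not possible, because the
compression maps only `𝓕` into `B i`; but the completely positive contraction `B i → F i` extends to
one on `A`, by Arveson's theorem. The compositions `A → A → F i → B i ⊆ A`, summed over `i`,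
factor through `⨁ i, F i`, which is a sum of at most `(d + 1) * (n + 1)` pieces on which the second
map is contractive and of order zero (`HasNuclearApprox.sigma`). The norm of the first map is the
maximum over the pieces, so it stays at most `1`.

Only finite-dimensional targets occur, and for these Arveson's theorem has a short proof by trace
duality. The trace `τ(a) = Tr(x ↦ a x)` of a finite-dimensional C*-algebra `F` is positive, faithful
and tracial (`regularTrace`), so with an orthonormal basis `e` of `F` for `τ(x* y)` completely
positive maps `ψ : C → F` correspond to positive functionals on matrices over `C`, by
`M ↦ ∑ᵢⱼ τ(eᵢ* ψ(Mᵢⱼ) eⱼ)` in one direction (`dualFunctional`, `dualMap`). Positive functionals on a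
unital C*-subalgebra extend by M. Riesz's theorem (`exists_positive_extension`). To keep the
extension contractive, the algebras are first replaced by their unitizations
(`exists_contractive_completelyPositive_extension`): the unital extension of a completely positive
contraction is completely positive, by an approximate unit argument, and unital completely positive
maps are contractive by the Schwarz inequality.

An approximation on a set of dense span suffices, since the composed maps have norm at most the
number of pieces (`hasNuclearApprox_of_dense_span`).
-/

section CompletelyPositive

open scoped ComplexOrder
open CStarMatrix

/-! ### Positive elements -/

section Positivity

theorem IsSelfAdjoint.eq_zero_of_mul_mul_self_eq_zero {A : Type*} [NonUnitalCStarAlgebra A]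
    {n : A} (hn : IsSelfAdjoint n) (h : n * n * n = 0) : n = 0 := by
  have h2 : n * n = 0 := by
    rw [← CStarRing.star_mul_self_eq_zero_iff, star_mul, hn.star_eq, ← mul_assoc, h, zero_mul]
  rw [← CStarRing.star_mul_self_eq_zero_iff, hn.star_eq, h2]

theorem negPart_mul_self_mul_negPart {A : Type*} [NonUnitalCStarAlgebra A] {a : A}
    (ha : IsSelfAdjoint a) : a⁻ * a * a⁻ = -(a⁻ * a⁻ * a⁻) := by
  have h : a⁻ * a = a⁻ * (a⁺ - a⁻) := by rw [CFC.posPart_sub_negPart a]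
  rw [h, mul_sub, CFC.negPart_mul_posPart, zero_sub, neg_mul]

variable {A B : Type*} [NonUnitalCStarAlgebra A] [PartialOrder A] [StarOrderedRing A]
  [NonUnitalCStarAlgebra B] [PartialOrder B] [StarOrderedRing B]

/-- The negative part of a self-adjoint element, in a form that does not refer to the functional
calculus. -/
theorem exists_negative_part {a : A} (ha : IsSelfAdjoint a) :
    ∃ n : A, 0 ≤ n ∧ n * a * n = -(n * n * n) ∧ (n = 0 → 0 ≤ a) :=
  ⟨a⁻, CFC.negPart_nonneg a, negPart_mul_self_mul_negPart ha, (CFC.negPart_eq_zero_iff a ha).1⟩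

/-- Injective *-homomorphisms reflect positivity: the negative part `n` of `a` satisfies
`n a n = -n³`, so a positive image forces `n = 0`. -/
theorem nonneg_of_map_nonneg (f : A →⋆ₙₐ[ℂ] B) (hf : Function.Injective f) {a : A}
    (ha : 0 ≤ f a) : 0 ≤ a := by
  have hsa : IsSelfAdjoint a := hf <| by rw [map_star, (IsSelfAdjoint.of_nonneg ha).star_eq]
  obtain ⟨n, hn, hna, hn0⟩ := exists_negative_part hsa
  have hns : IsSelfAdjoint (f n) := (IsSelfAdjoint.of_nonneg hn).map f
  have h1 : f (n * n * n) ≤ 0 := by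
    have := hns.conjugate_nonneg ha
    rwa [← map_mul, ← map_mul, hna, map_neg, neg_nonneg] at this
  have h2 : 0 ≤ f (n * n * n) := by
    rw [map_mul, map_mul]
    exact hns.conjugate_nonneg (map_nonneg f hn)
  have h3 : n * n * n = 0 := hf <| by rw [le_antisymm h1 h2, map_zero]
  exact hn0 <| (IsSelfAdjoint.of_nonneg hn).eq_zero_of_mul_mul_self_eq_zero h3

theorem exists_eq_star_mul_self {a : A} (ha : 0 ≤ a) : ∃ s : A, a = star s * s :=
  CStarAlgebra.nonneg_iff_eq_star_mul_self.1 ha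

end Positivity

/-! ### Positive matrices over a C*-algebra -/

section Matrix

namespace CStarMatrix

variable {A : Type*} [NonUnitalCStarAlgebra A] {n : Type*} [Fintype n]

theorem star_mul_self_apply (S : CStarMatrix n n A) (i j : n) :
    (star S * S) i j = ∑ p, star (S p i) * S p j := by
  simp [mul_apply, star_apply]

variable [PartialOrder A] [StarOrderedRing A]

theorem nonneg_diag {M : CStarMatrix n n A} (hM : 0 ≤ M) (i : n) : 0 ≤ M i i := by
  obtain ⟨S, rfl⟩ := exists_eq_star_mul_self hM
  rw [star_mul_self_apply]
  exact Finset.sum_nonneg fun p _ => star_mul_self_nonneg _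

/-- The rank one matrix `(wᵢ* wⱼ)` is `S* S` for the matrix `S` with a single nonzero row `w`. -/
theorem nonneg_of_star_mul (w : n → A) : 0 ≤ (ofMatrix fun i j => star (w i) * w j) := by
  classical
  rcases isEmpty_or_nonempty n with h | ⟨⟨p⟩⟩
  · exact le_of_eq (ext fun i => isEmptyElim i)
  · convert star_mul_self_nonneg
      (ofMatrix (fun q j => if q = p then w j else 0) : CStarMatrix n n A) using 1
    ext i j
    rw [star_mul_self_apply, Finset.sum_eq_single p (fun q _ hq => ?_) (by simp)]
    · change star (w i) * w j = star (if p = p then w i else 0) * if p = p then w j else 0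
      simp
    · change star (if q = p then w i else 0) * (if q = p then w j else 0) = 0
      simp [hq]

end CStarMatrix

end Matrix

/-! ### Extension of positive functionals -/

section Extension

variable {B E : Type*} [CStarAlgebra B] [PartialOrder B] [StarOrderedRing B]
  [CStarAlgebra E] [PartialOrder E] [StarOrderedRing E]

/-- The Riesz extension theorem for the cone of elements with positive real part: it contains
all skew-adjoint elements, so the complexification of the extended real functional is positive. -/
theorem exists_positive_extension (J : B →⋆ₙₐ[ℂ] E) (hJ : Function.Injective J) (hJ1 : J 1 = 1)
    (f : B →ₚ[ℂ] ℂ) : ∃ g : E →ₚ[ℂ] ℂ, ∀ b, g (J b) = f b := by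
  let s : PointedCone ℝ E :=
    { carrier := {x | 0 ≤ x + star x}
      zero_mem' := by simp
      add_mem' := fun {x y} hx hy => by
        have := add_nonneg hx hy
        simp only [Set.mem_ofPred_eq, star_add] at this ⊢
        rwa [add_add_add_comm]
      smul_mem' := fun c x hx => by
        have h : 0 ≤ (c : ℝ) • (x + star x) := smul_nonneg c.2 hx
        have h2 : star ((c : ℝ) • x) = (c : ℝ) • star x := by
          rw [star_smul, star_trivial]
        change 0 ≤ (c : ℝ) • x + star ((c : ℝ) • x)
        rwa [h2, ← smul_add] }
  have hs : ∀ x, x ∈ s ↔ 0 ≤ x + star x := fun x => Iff.rfl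
  let Jr : B →ₗ[ℝ] E := (J : B →ₗ[ℂ] E).restrictScalars ℝ
  have hJr : Function.Injective Jr := hJ
  let e := LinearEquiv.ofInjective Jr hJr
  let fr : B →ₗ[ℝ] ℝ := Complex.reLm.comp ((f : B →ₗ[ℂ] ℂ).restrictScalars ℝ)
  let F : E →ₗ.[ℝ] ℝ := ⟨LinearMap.range Jr, fr.comp (e.symm : LinearMap.range Jr →ₗ[ℝ] B)⟩
  have hF : ∀ b (hb : J b ∈ F.domain), F ⟨J b, hb⟩ = (f b).re := by
    intro b hb
    have : e.symm ⟨J b, hb⟩ = b := by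
      rw [LinearEquiv.symm_apply_eq]; rfl
    change fr (e.symm ⟨J b, hb⟩) = _
    rw [this]; rfl
  have hnonneg : ∀ x : F.domain, (x : E) ∈ s → 0 ≤ F x := by
    rintro ⟨_, b, rfl⟩ hb
    refine le_of_le_of_eq ?_ (hF b ⟨b, rfl⟩).symm
    have h0 : 0 ≤ b + star b := nonneg_of_map_nonneg J hJ <| by
      rw [map_add, map_star]; exact hb
    have h1 : 0 ≤ f b + star (f b) := by
      rw [← map_star, ← map_add]; exact map_nonneg f h0
    have h2 := (Complex.le_def.1 h1).1
    simp at h2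
    linarith
  -- A large multiple of the unit moves any element into the cone.
  have hdense : ∀ y, ∃ x : F.domain, (x : E) + y ∈ s := by
    intro y
    refine ⟨⟨J (algebraMap ℝ B ‖y + star y‖), _, rfl⟩, ?_⟩
    have h1 : J (algebraMap ℝ B ‖y + star y‖) = algebraMap ℝ E ‖y + star y‖ := by
      rw [Algebra.algebraMap_eq_smul_one, Algebra.algebraMap_eq_smul_one, ← hJ1]
      exact map_smul Jr _ _
    have hy : IsSelfAdjoint (y + star y) := .add_star_self y
    have h2 : 0 ≤ algebraMap ℝ E ‖y + star y‖ := by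
      rw [Algebra.algebraMap_eq_smul_one]; exact smul_nonneg (norm_nonneg _) zero_le_one
    have h3 := hy.neg_algebraMap_norm_le_self
    rw [hs]
    change 0 ≤ J (algebraMap ℝ B ‖y + star y‖) + y + star (J (algebraMap ℝ B ‖y + star y‖) + y)
    rw [h1, star_add, (IsSelfAdjoint.of_nonneg h2).star_eq]
    calc (0 : E) ≤ algebraMap ℝ E ‖y + star y‖ + (algebraMap ℝ E ‖y + star y‖ + (y + star y)) :=
          add_nonneg h2 (neg_le_iff_add_nonneg'.1 h3)
      _ = _ := by abel
  obtain ⟨g, hg, hgs⟩ := riesz_extension s F hnonneg hdense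
  have hskew : ∀ x : E, IsSelfAdjoint x → g (Complex.I • x) = 0 := by
    intro x hx
    apply le_antisymm
    · have : 0 ≤ g (-(Complex.I • x)) := hgs _ (by simp [hs, star_smul, hx.star_eq])
      rwa [map_neg, neg_nonneg] at this
    · exact hgs _ (by simp [hs, star_smul, hx.star_eq])
  refine ⟨PositiveLinearMap.mk₀ (Module.Dual.extendRCLike (𝕜 := ℂ) g) fun x hx => ?_, fun b => ?_⟩
  · rw [Module.Dual.extendRCLike_apply]
    have h1 := hskew x (.of_nonneg hx)
    have h2 : 0 ≤ g x := hgs x (by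
      rw [hs, (IsSelfAdjoint.of_nonneg hx).star_eq]; exact add_nonneg hx hx)
    simp [h1, h2]
  · have hre : ∀ b, g (J b) = (f b).re := fun b => by
      rw [← hF b ⟨b, rfl⟩, ← hg]
    change Module.Dual.extendRCLike (𝕜 := ℂ) g (J b) = f b
    rw [Module.Dual.extendRCLike_apply]
    have h1 : g ((RCLike.I : ℂ) • J b) = -(f b).im := by
      rw [← map_smul, hre, map_smul]; simp
    rw [h1, hre]
    apply Complex.ext <;> simp

end Extension

/-! ### The regular trace of a finite-dimensional C*-algebra -/

section Trace

variable {F : Type*} [CStarAlgebra F]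

/-- If left multiplication by `u` is bijective, then surjectivity gives a right inverse of `u`, and
injectivity makes it a left inverse. -/
theorem spectrum_lmul_eq (a : F) : spectrum ℂ (Algebra.lmul ℂ F a) = spectrum ℂ a := by
  apply subset_antisymm (AlgHom.spectrum_apply_subset _ _)
  intro r hr h
  apply hr
  rw [spectrum.mem_resolventSet_iff, ← AlgHom.commutes (Algebra.lmul ℂ F), ← map_sub] at h
  set u := algebraMap ℂ F r - a
  have hb : Function.Bijective (Algebra.lmul ℂ F u) := (Module.End.isUnit_iff _).1 h
  obtain ⟨v, hv⟩ := hb.2 1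
  have hv : u * v = 1 := hv
  have hv' : v * u = 1 := hb.1 <| by
    change u * (v * u) = u * 1
    rw [← mul_assoc, hv, one_mul, mul_one]
  exact ⟨⟨u, v, hv, hv'⟩, rfl⟩

variable [FiniteDimensional ℂ F]

theorem trace_lmul_eq_sum_roots (a : F) :
    LinearMap.trace ℂ F (Algebra.lmul ℂ F a) = (Algebra.lmul ℂ F a).charpoly.roots.sum :=
  Module.End.trace_eq_sum_roots_charpoly_of_splits (IsAlgClosed.splits _)

variable [PartialOrder F] [StarOrderedRing F]

theorem nonneg_of_mem_roots {a : F} (ha : 0 ≤ a) {r : ℂ}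
    (hr : r ∈ (Algebra.lmul ℂ F a).charpoly.roots) : 0 ≤ r := by
  have h := Polynomial.isRoot_of_mem_roots hr
  rw [← Module.End.mem_spectrum_iff_isRoot_charpoly, spectrum_lmul_eq] at h
  exact spectrum_nonneg_of_nonneg ha h

variable (F) in
/-- The trace of the left regular representation, as a positive functional. -/
noncomputable def regularTrace : F →ₚ[ℂ] ℂ :=
  PositiveLinearMap.mk₀ (LinearMap.trace ℂ F ∘ₗ (Algebra.lmul ℂ F).toLinearMap) fun a ha => by
    rw [LinearMap.comp_apply, AlgHom.toLinearMap_apply, trace_lmul_eq_sum_roots]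
    exact Multiset.sum_nonneg fun r hr => nonneg_of_mem_roots ha hr

theorem regularTrace_apply (a : F) :
    regularTrace F a = LinearMap.trace ℂ F (Algebra.lmul ℂ F a) := rfl

theorem regularTrace_mul_comm (a b : F) : regularTrace F (a * b) = regularTrace F (b * a) := by
  simp only [regularTrace_apply, map_mul]
  exact LinearMap.trace_mul_comm ℂ _ _

/-- A positive element of trace zero has spectrum `{0}`, as its eigenvalues are nonnegative. -/
theorem eq_zero_of_regularTrace_eq_zero {a : F} (ha : 0 ≤ a) (h : regularTrace F a = 0) :
    a = 0 := by
  rw [regularTrace_apply, trace_lmul_eq_sum_roots] at h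
  refine CFC.eq_zero_of_spectrum_subset_zero (R := ℂ) a fun r hr => ?_
  rw [← spectrum_lmul_eq, Module.End.mem_spectrum_iff_isRoot_charpoly] at hr
  exact Multiset.all_zero_of_le_zero_le_of_sum_eq_zero (fun r hr => nonneg_of_mem_roots ha hr) h r
    (Polynomial.mem_roots'.2 ⟨(LinearMap.charpoly_monic _).ne_zero, hr⟩)

theorem eq_zero_of_regularTrace_star_mul_self {a : F} (h : regularTrace F (star a * a) = 0) :
    a = 0 :=
  (CStarRing.star_mul_self_eq_zero_iff a).1 <|
    eq_zero_of_regularTrace_eq_zero (star_mul_self_nonneg a) h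

end Trace

theorem exists_orthonormal_expansion {V : Type*} [AddCommGroup V] [Module ℂ V]
    [FiniteDimensional ℂ V] (c : InnerProductSpace.Core ℂ V) :
    ∃ (m : ℕ) (e : Fin m → V), ∀ x, ∑ i, c.inner (e i) x • e i = x := by
  let : NormedAddCommGroup V := c.toNormedAddCommGroup
  let : InnerProductSpace ℂ V := InnerProductSpace.ofCore c.toCore
  exact ⟨_, stdOrthonormalBasis ℂ V, fun x => (stdOrthonormalBasis ℂ V).sum_repr' x⟩

section TraceBasis

variable {F : Type*} [CStarAlgebra F] [PartialOrder F] [StarOrderedRing F] [FiniteDimensional ℂ F]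

theorem star_regularTrace (a : F) : star (regularTrace F a) = regularTrace F (star a) :=
  (map_star _ a).symm

variable (F) in
/-- An orthonormal basis of `F` for the inner product `(x, y) ↦ τ(x* y)`; only the expansion of
vectors is recorded. -/
theorem exists_regularTrace_expansion :
    ∃ (m : ℕ) (e : Fin m → F), ∀ x, ∑ i, regularTrace F (star (e i) * x) • e i = x :=
  exists_orthonormal_expansion (V := F)
    { inner x y := regularTrace F (star x * y)
      conj_inner_symm x y := by
        rw [starRingEnd_apply, star_regularTrace, star_mul, star_star]
      re_inner_nonneg x :=
        (Complex.le_def.1 (map_nonneg (regularTrace F) (star_mul_self_nonneg x))).1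
      add_left x y z := by rw [star_add, add_mul, map_add]
      smul_left x y r := by rw [star_smul, smul_mul_assoc, map_smul, smul_eq_mul]; rfl
      definite x hx := eq_zero_of_regularTrace_star_mul_self hx }

/-- The trace form detects positivity of matrices: for `n` the negative part of `M`, the
hypothesis applied to the columns of `n` gives `τ(n³) ≤ 0`. -/
theorem CStarMatrix.nonneg_of_regularTrace {k : Type*} [Fintype k] {M : CStarMatrix k k F}
    (hM : IsSelfAdjoint M)
    (h : ∀ y : k → F, 0 ≤ ∑ p, ∑ q, regularTrace F (star (y p) * M p q * y q)) : 0 ≤ M := by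
  obtain ⟨n, hn, hna, hn0⟩ := exists_negative_part hM
  have hns : IsSelfAdjoint n := .of_nonneg hn
  apply hn0
  apply hns.eq_zero_of_mul_mul_self_eq_zero
  obtain ⟨S, hS⟩ := exists_eq_star_mul_self (hns.conjugate_nonneg hn)
  have h1 : ∀ j, regularTrace F ((n * n * n) j j) ≤ 0 := by
    intro j
    rw [← neg_nonneg, ← map_neg, ← neg_apply, ← hna]
    convert h fun p => n p j using 1
    rw [Finset.sum_comm, mul_apply, map_sum]
    refine Finset.sum_congr rfl fun q _ => ?_
    rw [mul_apply, Finset.sum_mul, map_sum]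
    refine Finset.sum_congr rfl fun p _ => ?_
    rw [star_apply_of_isSelfAdjoint hns]
  have h2 : ∀ j p, S p j = 0 := by
    intro j p
    have h3 : ∀ q ∈ Finset.univ, 0 ≤ regularTrace F (star (S q j) * S q j) := fun q _ =>
      map_nonneg _ (star_mul_self_nonneg _)
    have h4 := h1 j
    rw [hS, star_mul_self_apply, map_sum] at h4
    exact eq_zero_of_regularTrace_star_mul_self <|
      (Finset.sum_eq_zero_iff_of_nonneg h3).1 (le_antisymm h4 (Finset.sum_nonneg h3)) p
        (Finset.mem_univ p)
  have h5 : S = 0 := ext fun p j => h2 j p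
  rw [hS, h5, star_zero, zero_mul]

end TraceBasis

theorem map_star_of_positive {A : Type*} [NonUnitalCStarAlgebra A] [PartialOrder A]
    [StarOrderedRing A] (g : A →ₚ[ℂ] ℂ) (a : A) : g (star a) = star (g a) :=
  map_star g a

theorem CStarMatrix.sum_apply {ι m n A : Type*} [AddCommMonoid A] (t : Finset ι)
    (f : ι → CStarMatrix m n A) (i : m) (j : n) : (∑ x ∈ t, f x) i j = ∑ x ∈ t, f x i j :=
  Matrix.sum_apply i j t f

theorem sum_sum_sum_sum_comm {α β γ δ M : Type*} [Fintype α] [Fintype β] [Fintype γ] [Fintype δ]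
    [AddCommMonoid M] (f : α → β → γ → δ → M) :
    ∑ a, ∑ b, ∑ c, ∑ d, f a b c d = ∑ c, ∑ d, ∑ a, ∑ b, f a b c d := by
  calc ∑ a, ∑ b, ∑ c, ∑ d, f a b c d = ∑ a, ∑ c, ∑ b, ∑ d, f a b c d :=
        Finset.sum_congr rfl fun _ _ => Finset.sum_comm
    _ = ∑ c, ∑ a, ∑ d, ∑ b, f a b c d := by
        rw [Finset.sum_comm]
        exact Finset.sum_congr rfl fun _ _ => Finset.sum_congr rfl fun _ _ => Finset.sum_comm
    _ = ∑ c, ∑ d, ∑ a, ∑ b, f a b c d := Finset.sum_congr rfl fun _ _ => Finset.sum_comm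

/-! ### Completely positive maps into finite-dimensional algebras -/

section Duality

variable {B C F : Type*} [CStarAlgebra B] [PartialOrder B] [StarOrderedRing B]
  [CStarAlgebra C] [CStarAlgebra F] [PartialOrder F] [StarOrderedRing F] [FiniteDimensional ℂ F]
  {m : ℕ} {e : Fin m → F}

theorem eq_zero_of_regularTrace_mul {x : F} (h : ∀ y, regularTrace F (x * y) = 0) : x = 0 :=
  eq_zero_of_regularTrace_star_mul_self (by rw [regularTrace_mul_comm, h])

theorem sum_regularTrace_smul_star (he : ∀ x, ∑ i, regularTrace F (star (e i) * x) • e i = x)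
    (y : F) : ∑ i, regularTrace F (e i * y) • star (e i) = y := by
  conv_rhs => rw [← star_star y, ← he (star y), star_sum]
  refine Finset.sum_congr rfl fun i _ => ?_
  rw [star_smul, star_regularTrace, star_mul, star_star, star_star, regularTrace_mul_comm]

variable (C e) in
/-- The matrix `(τ(eⱼ* y eᵢ) a)ᵢⱼ`, i.e. the elementary tensor of `a` and the transpose of the
matrix by which `y` acts from the left in the orthonormal basis `e`. -/
noncomputable def traceTensor : F →ₗ[ℂ] C →ₗ[ℂ] CStarMatrix (Fin m) (Fin m) C :=
  LinearMap.mk₂ ℂ (fun y a => ofMatrix fun i j => regularTrace F (star (e j) * y * e i) • a)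
    (fun y z a => ext fun i j => by
      change regularTrace F (star (e j) * (y + z) * e i) • a =
        regularTrace F (star (e j) * y * e i) • a + regularTrace F (star (e j) * z * e i) • a
      rw [mul_add, add_mul, map_add, add_smul])
    (fun c y a => ext fun i j => by
      change regularTrace F (star (e j) * (c • y) * e i) • a =
        c • regularTrace F (star (e j) * y * e i) • a
      rw [mul_smul_comm, smul_mul_assoc, map_smul, smul_assoc])
    (fun y a b => ext fun i j => smul_add (regularTrace F (star (e j) * y * e i)) a b)
    (fun c y a => ext fun i j => smul_comm (regularTrace F (star (e j) * y * e i)) c a)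

theorem traceTensor_apply (y : F) (a : C) (i j : Fin m) :
    traceTensor C e y a i j = regularTrace F (star (e j) * y * e i) • a := rfl

theorem star_traceTensor (y : F) (a : C) :
    star (traceTensor C e y a) = traceTensor C e (star y) (star a) := by
  ext i j
  rw [star_apply, traceTensor_apply, traceTensor_apply, star_smul, star_regularTrace, star_mul,
    star_mul, star_star, mul_assoc]

variable [PartialOrder C] [StarOrderedRing C]

variable (e) in
/-- The linear map `φ : C → F` dual to a functional `g` on matrices over `C`: it is determined by
`τ(φ(a) y) = g(traceTensor y a)`. -/
noncomputable def dualMap (g : CStarMatrix (Fin m) (Fin m) C →ₚ[ℂ] ℂ) : C →ₗ[ℂ] F where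
  toFun a := ∑ k, g (traceTensor C e (star (e k)) a) • e k
  map_add' a b := by simp [add_smul, Finset.sum_add_distrib]
  map_smul' c a := by simp [SemigroupAction.mul_smul, Finset.smul_sum]

theorem regularTrace_dualMap_mul (he : ∀ x, ∑ i, regularTrace F (star (e i) * x) • e i = x)
    (g : CStarMatrix (Fin m) (Fin m) C →ₚ[ℂ] ℂ) (a : C) (y : F) :
    regularTrace F (dualMap e g a * y) = g (traceTensor C e y a) := by
  conv_rhs => rw [← sum_regularTrace_smul_star he y]
  change regularTrace F ((∑ k, g (traceTensor C e (star (e k)) a) • e k) * y) = _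
  simp only [Finset.sum_mul, map_sum, smul_mul_assoc, map_smul, LinearMap.sum_apply,
    LinearMap.smul_apply, smul_eq_mul]
  exact Finset.sum_congr rfl fun _ _ => mul_comm _ _

theorem star_dualMap (he : ∀ x, ∑ i, regularTrace F (star (e i) * x) • e i = x)
    (g : CStarMatrix (Fin m) (Fin m) C →ₚ[ℂ] ℂ) (a : C) :
    star (dualMap e g a) = dualMap e g (star a) := by
  rw [← sub_eq_zero]
  refine eq_zero_of_regularTrace_mul fun y => ?_
  rw [sub_mul, map_sub, sub_eq_zero, regularTrace_dualMap_mul he, ← star_star y,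
    ← star_traceTensor, map_star_of_positive, ← regularTrace_dualMap_mul he,
    star_regularTrace, star_mul, regularTrace_mul_comm]

/-- The matrix tensor `∑ₚ,q traceTensor (y_q y_p*) P_pq` is positive because
`τ(eⱼ* y_q y_p* eᵢ) = ∑ᵣ τ(eⱼ* y_q eᵣ) conj(τ(eᵢ* y_p eᵣ))`. -/
theorem sum_traceTensor_nonneg (he : ∀ x, ∑ i, regularTrace F (star (e i) * x) • e i = x)
    {k : Type*} [Fintype k] {P : CStarMatrix k k C} (hP : 0 ≤ P) (y : k → F) :
    0 ≤ ∑ p, ∑ q, traceTensor C e (y q * star (y p)) (P p q) := by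
  obtain ⟨S, rfl⟩ := exists_eq_star_mul_self hP
  have key : ∑ p, ∑ q, traceTensor C e (y q * star (y p)) ((star S * S) p q) =
      ∑ r : Fin m, ∑ s : k, (ofMatrix fun i j =>
        star (∑ p, regularTrace F (star (e i) * y p * e r) • S s p) *
          ∑ q, regularTrace F (star (e j) * y q * e r) • S s q) := by
    have hexp : ∀ p q i j, regularTrace F (star (e j) * (y q * star (y p)) * e i) =
        ∑ r, regularTrace F (star (e j) * y q * e r) *
          star (regularTrace F (star (e i) * y p * e r)) := by
      intro p q i j
      have h := he (star (y p) * e i)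
      calc regularTrace F (star (e j) * (y q * star (y p)) * e i)
          = regularTrace F (star (e j) * y q * (star (y p) * e i)) := by simp only [mul_assoc]
        _ = _ := by
          rw [← h, Finset.mul_sum, map_sum]
          refine Finset.sum_congr rfl fun r _ => ?_
          rw [mul_smul_comm, map_smul, smul_eq_mul, mul_comm, star_regularTrace]
          simp only [star_mul, star_star, mul_assoc]
    ext i j
    have hl : (∑ p, ∑ q, traceTensor C e (y q * star (y p)) ((star S * S) p q)) i j =
        ∑ p, ∑ q, ∑ r, ∑ s, (regularTrace F (star (e j) * y q * e r) *
          star (regularTrace F (star (e i) * y p * e r))) • (star (S s p) * S s q) := by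
      rw [CStarMatrix.sum_apply]
      refine Finset.sum_congr rfl fun p _ => ?_
      rw [CStarMatrix.sum_apply]
      refine Finset.sum_congr rfl fun q _ => ?_
      rw [traceTensor_apply, hexp, star_mul_self_apply, Finset.sum_smul_sum]
    rw [hl, sum_sum_sum_sum_comm, CStarMatrix.sum_apply]
    refine Finset.sum_congr rfl fun r _ => ?_
    rw [CStarMatrix.sum_apply]
    refine Finset.sum_congr rfl fun s _ => ?_
    change _ = star (∑ p, regularTrace F (star (e i) * y p * e r) • S s p) *
      ∑ q, regularTrace F (star (e j) * y q * e r) • S s q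
    rw [star_sum, Finset.sum_mul_sum]
    refine Finset.sum_congr rfl fun p _ => Finset.sum_congr rfl fun q _ => ?_
    rw [star_smul, smul_mul_smul_comm, mul_comm (star _)]
  rw [key]
  exact Finset.sum_nonneg fun r _ => Finset.sum_nonneg fun s _ => nonneg_of_star_mul _

/-- The map dual to a positive functional is completely positive. -/
theorem dualMap_map_nonneg (he : ∀ x, ∑ i, regularTrace F (star (e i) * x) • e i = x)
    (g : CStarMatrix (Fin m) (Fin m) C →ₚ[ℂ] ℂ) {k : Type*} [Fintype k] {P : CStarMatrix k k C}
    (hP : 0 ≤ P) : 0 ≤ P.map (dualMap e g) := by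
  apply nonneg_of_regularTrace
  · rw [isSelfAdjoint_iff]
    ext p q
    rw [star_apply, map_apply, map_apply, star_dualMap he,
      star_apply_of_isSelfAdjoint (.of_nonneg hP)]
  · intro y
    have h := map_nonneg g (sum_traceTensor_nonneg he hP y)
    simp only [map_sum, ← regularTrace_dualMap_mul he] at h
    refine h.trans_eq (Finset.sum_congr rfl fun p _ => Finset.sum_congr rfl fun q _ => ?_)
    rw [map_apply, ← mul_assoc, regularTrace_mul_comm, mul_assoc]

/-- The functional `M ↦ ∑ᵢⱼ τ(eᵢ* ψ(Mᵢⱼ) eⱼ)` on matrices over `B` dual to a completely positive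
map `ψ : B → F`. -/
noncomputable def dualFunctional (e : Fin m → F) (ψ : B →CP F) :
    CStarMatrix (Fin m) (Fin m) B →ₚ[ℂ] ℂ :=
  PositiveLinearMap.mk₀
    { toFun M := ∑ i, ∑ j, regularTrace F (star (e i) * ψ (M i j) * e j)
      map_add' M N := by simp [mul_add, add_mul, Finset.sum_add_distrib]
      map_smul' c M := by simp [Finset.mul_sum] }
    fun M hM => by
      obtain ⟨S, hS⟩ := exists_eq_star_mul_self (ψ.map_cstarMatrix_nonneg M hM)
      have h : ∀ i j, ψ (M i j) = ∑ p, star (S p i) * S p j := fun i j => by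
        rw [← star_mul_self_apply, ← hS, map_apply]
      change 0 ≤ ∑ i, ∑ j, regularTrace F (star (e i) * ψ (M i j) * e j)
      have h2 : ∑ i, ∑ j, regularTrace F (star (e i) * ψ (M i j) * e j) =
          regularTrace F (∑ p, star (∑ i, S p i * e i) * ∑ j, S p j * e j) := by
        calc _ = ∑ i, ∑ j, ∑ p, regularTrace F (star (S p i * e i) * (S p j * e j)) :=
              Finset.sum_congr rfl fun i _ => Finset.sum_congr rfl fun j _ => by
                rw [h, Finset.mul_sum, Finset.sum_mul, map_sum]
                simp only [star_mul, mul_assoc]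
          _ = ∑ i, ∑ p, ∑ j, regularTrace F (star (S p i * e i) * (S p j * e j)) :=
              Finset.sum_congr rfl fun i _ => Finset.sum_comm
          _ = _ := by
              rw [Finset.sum_comm, map_sum]
              refine Finset.sum_congr rfl fun p _ => ?_
              rw [star_sum, Finset.sum_mul_sum, map_sum]
              exact Finset.sum_congr rfl fun i _ => (map_sum _ _ _).symm
      rw [h2]
      exact map_nonneg _ (Finset.sum_nonneg fun p _ => star_mul_self_nonneg _)

theorem dualFunctional_apply (ψ : B →CP F) (M : CStarMatrix (Fin m) (Fin m) B) :
    dualFunctional e ψ M = ∑ i, ∑ j, regularTrace F (star (e i) * ψ (M i j) * e j) := rfl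

/-- The regular trace is the sum of the diagonal coefficients of left multiplication. -/
theorem sum_regularTrace_basis (he : ∀ x, ∑ i, regularTrace F (star (e i) * x) • e i = x) (a : F) :
    ∑ i, regularTrace F (star (e i) * a * e i) = regularTrace F a := by
  have h : Algebra.lmul ℂ F a = ∑ i, LinearMap.smulRight
      ((regularTrace F : F →ₗ[ℂ] ℂ) ∘ₗ Algebra.lmul ℂ F (star (e i))) (a * e i) := by
    refine LinearMap.ext fun x => ?_
    conv_lhs => rw [← he x]
    simp
  rw [regularTrace_apply, h, map_sum]
  refine Finset.sum_congr rfl fun i _ => ?_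
  rw [LinearMap.trace_smulRight]
  simp [mul_assoc]

/-- Compared with `regularTrace_dualMap_mul`, this says that `dualMap` recovers `ψ` from
`dualFunctional e ψ`. -/
theorem dualFunctional_traceTensor (he : ∀ x, ∑ i, regularTrace F (star (e i) * x) • e i = x)
    (ψ : B →CP F) (y : F) (b : B) :
    dualFunctional e ψ (traceTensor B e y b) = regularTrace F (ψ b * y) := by
  rw [dualFunctional_apply, ← sum_regularTrace_basis he]
  refine Finset.sum_congr rfl fun i _ => ?_
  have h : star (e i) * (ψ b * y) * e i = star (e i) * ψ b * (y * e i) := by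
    simp only [mul_assoc]
  rw [h, ← he (y * e i), Finset.mul_sum, map_sum]
  refine Finset.sum_congr rfl fun j _ => ?_
  rw [traceTensor_apply, map_smul, mul_smul_comm, smul_mul_assoc, mul_smul_comm, mul_assoc (star _)]

/-- Arveson's extension theorem for finite-dimensional targets: completely positive maps into `F`
correspond to positive functionals on matrices, and these extend. -/
theorem exists_completelyPositive_extension (j : B →⋆ₐ[ℂ] C) (hj : Function.Injective j)
    (ψ : B →CP F) : ∃ ψ' : C →CP F, ∀ b, ψ' (j b) = ψ b := by
  obtain ⟨m, e, he⟩ := exists_regularTrace_expansion F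
  obtain ⟨g, hg⟩ := exists_positive_extension
    (mapₙₐ (n := Fin m) (j : B →⋆ₙₐ[ℂ] C)) (map_injective hj)
    (by ext p q; by_cases h : p = q <;> simp [one_apply, h]) (dualFunctional e ψ)
  refine ⟨⟨dualMap e g, fun k M hM => dualMap_map_nonneg he g hM⟩, fun b => ?_⟩
  change dualMap e g (j b) = ψ b
  rw [← sub_eq_zero]
  refine eq_zero_of_regularTrace_mul fun y => ?_
  rw [sub_mul, map_sub, sub_eq_zero, regularTrace_dualMap_mul he, ← dualFunctional_traceTensor he,
    ← hg]
  congr 1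
  ext p q
  simp [traceTensor_apply]

end Duality

/-! ### Unitization and contractivity -/

section Unitization

open Filter Topology

theorem tendsto_conjugate_of_isIncreasingApproximateUnit {B : Type*} [NonUnitalCStarAlgebra B]
    [PartialOrder B] {l : Filter B} (hl : l.IsIncreasingApproximateUnit) (b : B) :
    Tendsto (fun v => v * b * v) l (𝓝 b) := by
  have h1 := tendsto_iff_norm_sub_tendsto_zero.1 (hl.tendsto_mul_left b)
  have h2 := tendsto_iff_norm_sub_tendsto_zero.1 (hl.tendsto_mul_right b)
  rw [tendsto_iff_norm_sub_tendsto_zero]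
  refine squeeze_zero' (.of_forall fun _ => norm_nonneg _) ?_ (by simpa using h1.add h2)
  filter_upwards [hl.eventually_norm] with v hv
  calc ‖v * b * v - b‖ = ‖v * (b * v - b) + (v * b - b)‖ := by
        rw [mul_sub, mul_assoc, sub_add_sub_cancel]
    _ ≤ ‖v‖ * ‖b * v - b‖ + ‖v * b - b‖ :=
        (norm_add_le _ _).trans (add_le_add_left (norm_mul_le _ _) _)
    _ ≤ ‖b * v - b‖ + ‖v * b - b‖ :=
        add_le_add_left (mul_le_of_le_one_left (norm_nonneg _) hv) _

variable {B F : Type*} [NonUnitalCStarAlgebra B] [CStarAlgebra F]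

/-- The unital extension of a linear map `B → F` to the unitization of `B`. -/
noncomputable def unitalExtension (ψ : B →ₗ[ℂ] F) : B⁺¹ →ₗ[ℂ] F where
  toFun x := ψ x.snd + x.fst • 1
  map_add' x y := by simp [add_smul]; abel
  map_smul' c x := by simp [SemigroupAction.mul_smul]

variable [PartialOrder B] [StarOrderedRing B] [PartialOrder F] [StarOrderedRing F]

theorem CompletelyPositiveMap.apply_le_one {ψ : B →CP F} (hψ : ∀ b, ‖ψ b‖ ≤ ‖b‖) {v : B}
    (hv : 0 ≤ v) (hv1 : ‖v‖ ≤ 1) : ψ v ≤ 1 :=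
  (CStarAlgebra.norm_le_one_iff_of_nonneg (ψ v) (map_nonneg ψ hv)).1 ((hψ v).trans hv1)

/-- For a positive matrix `(λᵢⱼ + bᵢⱼ)` over the unitization and a positive contraction `v` of `B`,
the matrix `(ψ(v bᵢⱼ v) + λᵢⱼ)` is the sum of the image under `ψ` of the matrix
`(v (λᵢⱼ + bᵢⱼ) v)` over `B` and of the matrix `(λᵢⱼ (1 - ψ(v²)))`, both of which are positive. -/
theorem nonneg_conjugate_add_scalar {ψ : B →CP F} (hψ : ∀ b, ‖ψ b‖ ≤ ‖b‖) {k : Type*} [Fintype k]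
    {M : CStarMatrix k k B⁺¹} (hM : 0 ≤ M) {v : B} (hv : 0 ≤ v) (hv1 : ‖v‖ ≤ 1) :
    0 ≤ (ofMatrix fun i j => ψ (v * (M i j).snd * v) + (M i j).fst • 1 : CStarMatrix k k F) := by
  obtain ⟨S, rfl⟩ := exists_eq_star_mul_self hM
  have hvs : star v = v := IsSelfAdjoint.of_nonneg hv
  let T : CStarMatrix k k B := ofMatrix fun p j => (S p j).snd * v + (S p j).fst • v
  have hT : ∀ p j, T p j = (S p j).snd * v + (S p j).fst • v := fun _ _ => rfl
  have hTS : ∀ p j, (T p j : B⁺¹) = S p j * v := by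
    intro p j
    rw [hT]
    ext <;> simp [add_comm]
  have hTT : ∀ i j, (star T * T) i j =
      v * ((star S * S) i j).snd * v + ((star S * S) i j).fst • (v * v) := by
    intro i j
    apply Unitization.inr_injective (R := ℂ)
    have h1 : (((star T * T) i j : B) : B⁺¹) = v * (star S * S) i j * v := by
      rw [star_mul_self_apply, star_mul_self_apply, Finset.mul_sum, Finset.sum_mul]
      rw [← Unitization.inrHom_apply ℂ ℂ, map_sum]
      refine Finset.sum_congr rfl fun p _ => ?_
      rw [Unitization.inrHom_apply, Unitization.inr_mul, Unitization.inr_star, hTS, hTS, star_mul,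
        ← Unitization.inr_star, hvs]
      simp only [mul_assoc]
    rw [h1]
    ext <;> simp [add_mul, add_comm, smul_mul_assoc]
  have hd : 0 ≤ 1 - ψ (v * v) := by
    refine sub_nonneg.2 (CompletelyPositiveMap.apply_le_one hψ ?_ ?_)
    · nth_rw 1 [← hvs]
      exact star_mul_self_nonneg v
    · exact (norm_mul_le v v).trans (mul_le_one₀ hv1 (norm_nonneg v) hv1)
  obtain ⟨t, ht⟩ := exists_eq_star_mul_self hd
  let R : CStarMatrix k k F := ofMatrix fun p j => (S p j).fst • t
  have hR : ∀ p j, R p j = (S p j).fst • t := fun _ _ => rfl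
  have hRR : ∀ i j, (star R * R) i j = ((star S * S) i j).fst • (1 - ψ (v * v)) := by
    intro i j
    have h1 : ((star S * S) i j).fst = ∑ p, star (S p i).fst * (S p j).fst := by
      rw [star_mul_self_apply, ← Unitization.fstHom_apply ℂ B, map_sum]
      simp
    rw [h1, star_mul_self_apply, ht, Finset.sum_smul]
    refine Finset.sum_congr rfl fun p _ => ?_
    rw [hR, hR, star_smul, smul_mul_smul_comm]
  have h := add_nonneg (ψ.map_cstarMatrix_nonneg _ (star_mul_self_nonneg T))
    (star_mul_self_nonneg R)
  convert h using 1
  ext i j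
  change _ = ψ ((star T * T) i j) + (star R * R) i j
  rw [hTT, hRR, map_add, map_smul, smul_sub]
  change ψ (v * ((star S * S) i j).snd * v) + ((star S * S) i j).fst • 1 = _
  abel

/-- The unital extension of a completely positive contraction is completely positive: the matrices
of `nonneg_conjugate_add_scalar` converge along an approximate unit. -/
theorem unitalExtension_map_nonneg {ψ : B →CP F} (hψ : ∀ b, ‖ψ b‖ ≤ ‖b‖) {k : Type*} [Fintype k]
    {M : CStarMatrix k k B⁺¹} (hM : 0 ≤ M) :
    0 ≤ M.map (unitalExtension (ψ : B →ₗ[ℂ] F)) := by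
  have hl := CStarAlgebra.increasingApproximateUnit B
  have hlim : Tendsto (fun v : B =>
      (ofMatrix fun i j => ψ (v * (M i j).snd * v) + (M i j).fst • 1 : CStarMatrix k k F))
      (CStarAlgebra.approximateUnit B) (𝓝 (M.map (unitalExtension (ψ : B →ₗ[ℂ] F)))) := by
    refine tendsto_pi_nhds.2 fun i => tendsto_pi_nhds.2 fun j => ?_
    change Tendsto (fun v : B => ψ (v * (M i j).snd * v) + (M i j).fst • (1 : F)) _
      (𝓝 (ψ (M i j).snd + (M i j).fst • 1))
    refine Tendsto.add_const _ ?_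
    refine ((map_continuous ψ).tendsto _).comp ?_
    exact tendsto_conjugate_of_isIncreasingApproximateUnit hl _
  have := hl.neBot
  refine (CStarAlgebra.isClosed_nonneg (A := CStarMatrix k k F)).mem_of_tendsto hlim ?_
  filter_upwards [hl.eventually_nonneg, hl.eventually_norm] with v hv hv1
  exact nonneg_conjugate_add_scalar hψ hM hv hv1

end Unitization

section Contractive

variable {C F : Type*} [CStarAlgebra C] [PartialOrder C] [StarOrderedRing C]
  [CStarAlgebra F] [PartialOrder F] [StarOrderedRing F]

/-- The Schwarz inequality for unital completely positive maps: the upper left entry of a conjugate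
of the positive matrix with rows `1, φ(c)` and `φ(c*), φ(c* c)`. -/
theorem star_apply_mul_apply_le (φ : C →CP F) (h1 : φ 1 = 1) (c : C) :
    star (φ c) * φ c ≤ φ (star c * c) := by
  let w : Fin 2 → C := ![1, c]
  have h := φ.map_cstarMatrix_nonneg _ (nonneg_of_star_mul w)
  let t : Fin 2 → F := ![-φ c, 1]
  let T : CStarMatrix (Fin 2) (Fin 2) F := ofMatrix fun i j => t i
  have h2 := nonneg_diag (star_left_conjugate_nonneg h T) 0
  have h3 : (star T * (ofMatrix fun i j => star (w i) * w j).map φ * T) 0 0 =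
      ∑ q, (∑ p, star (t p) * φ (star (w p) * w q)) * t q := rfl
  rw [h3] at h2
  simp [Fin.sum_univ_two, w, t, h1, map_star φ] at h2
  simpa using h2

theorem norm_apply_le_of_map_one (φ : C →CP F) (h1 : φ 1 = 1) (c : C) : ‖φ c‖ ≤ ‖c‖ := by
  have h2 : star (φ c) * φ c ≤ algebraMap ℝ F (‖c‖ ^ 2) := by
    refine (star_apply_mul_apply_le φ h1 c).trans ?_
    have h3 := OrderHomClass.mono φ (CStarAlgebra.star_mul_le_algebraMap_norm_sq (a := c))
    rwa [Algebra.algebraMap_eq_smul_one, ← Complex.coe_smul, map_smul, h1, Complex.coe_smul,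
      ← Algebra.algebraMap_eq_smul_one] at h3
  rw [← CStarAlgebra.norm_le_iff_le_algebraMap _ (sq_nonneg _) (star_mul_self_nonneg _),
    CStarRing.norm_star_mul_self, ← sq] at h2
  exact (sq_le_sq₀ (norm_nonneg _) (norm_nonneg c)).1 h2

end Contractive

section Extension

variable {A F : Type*} [NonUnitalCStarAlgebra A] [PartialOrder A] [StarOrderedRing A]
  {B : Type*} [NonUnitalCStarAlgebra B] [PartialOrder B] [StarOrderedRing B]
  [CStarAlgebra F] [PartialOrder F] [StarOrderedRing F] [FiniteDimensional ℂ F]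

/-- Arveson's extension theorem for completely positive contractions into a finite-dimensional
C*-algebra. Passing to the unitizations keeps the extension contractive, since unital completely
positive maps are. -/
theorem exists_contractive_completelyPositive_extension (j : B →⋆ₙₐ[ℂ] A)
    (hj : Function.Injective j) (ψ : B →CP F) (hψ : ∀ b, ‖ψ b‖ ≤ ‖b‖) :
    ∃ ψ' : A →CP F, (∀ b, ψ' (j b) = ψ b) ∧ ∀ a, ‖ψ' a‖ ≤ ‖a‖ := by
  obtain ⟨φ, hφ⟩ := exists_completelyPositive_extension (Unitization.starMap j)
    (Unitization.starMap_injective hj)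
    (⟨unitalExtension (ψ : B →ₗ[ℂ] F), fun k M hM => unitalExtension_map_nonneg hψ hM⟩ : B⁺¹ →CP F)
  have hφ' : ∀ x, φ (Unitization.starMap j x) = ψ x.snd + x.fst • 1 := hφ
  have h1 : φ 1 = 1 := by
    have := hφ' 1
    simpa using this
  refine ⟨⟨(φ : A⁺¹ →ₗ[ℂ] F) ∘ₗ Unitization.inrHom ℂ ℂ A, fun k M hM => ?_⟩, fun b => ?_,
    fun a => ?_⟩
  · exact φ.map_cstarMatrix_nonneg _
      (map_nonneg (mapₙₐ (Unitization.inrNonUnitalStarAlgHom ℂ A)) hM)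
  · change φ (j b : A⁺¹) = ψ b
    rw [← Unitization.starMap_inr, hφ']
    simp
  · change ‖φ (a : A⁺¹)‖ ≤ ‖a‖
    rw [← Unitization.norm_inr (𝕜 := ℂ) a]
    exact norm_apply_le_of_map_one φ h1 _

end Extension

/-! ### Operations on completely positive maps -/

namespace CompletelyPositiveMap

variable {A B C : Type*} [NonUnitalCStarAlgebra A] [PartialOrder A] [StarOrderedRing A]
  [NonUnitalCStarAlgebra B] [PartialOrder B] [StarOrderedRing B]
  [NonUnitalCStarAlgebra C] [PartialOrder C] [StarOrderedRing C]

/-- The composition of completely positive maps. -/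
def comp (g : B →CP C) (f : A →CP B) : A →CP C :=
  ⟨(g : B →ₗ[ℂ] C) ∘ₗ (f : A →ₗ[ℂ] B), fun _ M hM =>
    g.map_cstarMatrix_nonneg _ (f.map_cstarMatrix_nonneg M hM)⟩

/-- A *-homomorphism as a completely positive map. -/
def ofHom (f : A →⋆ₙₐ[ℂ] B) : A →CP B :=
  ⟨(f : A →ₗ[ℂ] B), fun _ _ hM => map_nonneg (mapₙₐ f) hM⟩

/-- The sum of a finite family of completely positive maps. -/
def sum {ι : Type*} [Fintype ι] (f : ι → (A →CP B)) : A →CP B :=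
  ⟨∑ i, (f i : A →ₗ[ℂ] B), fun k M hM => by
    have h : M.map ⇑(∑ i, (f i : A →ₗ[ℂ] B)) = ∑ i, M.map (f i) := by
      ext p q
      rw [CStarMatrix.sum_apply, map_apply, LinearMap.sum_apply]
      rfl
    rw [h]
    exact Finset.sum_nonneg fun i _ => (f i).map_cstarMatrix_nonneg M hM⟩

theorem sum_apply {ι : Type*} [Fintype ι] (f : ι → (A →CP B)) (a : A) : sum f a = ∑ i, f i a :=
  LinearMap.sum_apply _ _ _

/-- A finite family of completely positive maps, as a map into the product. -/
def pi {ι : Type*} [Fintype ι] {F : ι → Type*} [∀ i, NonUnitalCStarAlgebra (F i)]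
    [∀ i, PartialOrder (F i)] [∀ i, StarOrderedRing (F i)] (f : ∀ i, A →CP F i) :
    A →CP ∀ i, F i :=
  ⟨LinearMap.pi fun i => (f i : A →ₗ[ℂ] F i), fun k M hM => by
    choose S hS using fun i => exists_eq_star_mul_self ((f i).map_cstarMatrix_nonneg M hM)
    have h : M.map (LinearMap.pi fun i => (f i : A →ₗ[ℂ] F i)) =
        star (ofMatrix fun p q i => S i p q : CStarMatrix (Fin k) (Fin k) (∀ i, F i)) *
          (ofMatrix fun p q i => S i p q) := by
      refine ext fun p q => ?_
      rw [star_mul_self_apply]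
      refine funext fun i => ?_
      rw [Finset.sum_apply]
      change f i (M p q) = ∑ r, star (S i r p) * S i r q
      rw [← star_mul_self_apply, ← hS, map_apply]
    exact (star_mul_self_nonneg _).trans_eq h.symm⟩

end CompletelyPositiveMap

/-! ### Compressions by multipliers -/

section Compress

variable {A : Type*} [NonUnitalCStarAlgebra A]

theorem compress_star_mul (b : 𝓜(ℂ, A)) (x y : A) :
    compress b (star x * y) = star ((star b).snd x) * (star b).snd y := by
  have h : star ((star b).snd x) = b.fst (star x) := by
    rw [DoubleCentralizer.star_snd, star_star]
  rw [h, compress, multiplier_fst_mul, multiplier_snd_mul]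

theorem norm_compress_le {b : 𝓜(ℂ, A)} (hb : ‖b‖ ≤ 1) (x : A) : ‖compress b x‖ ≤ ‖x‖ := by
  have h1 : ‖(star b).snd‖ ≤ 1 := by rwa [DoubleCentralizer.norm_snd, norm_star]
  have h2 : ‖b.fst‖ ≤ 1 := by rwa [DoubleCentralizer.norm_fst]
  exact ((star b).snd.le_of_opNorm_le h1 _).trans <| by
    simpa using b.fst.le_of_opNorm_le h2 x

attribute [local instance] CStarAlgebra.spectralOrder CStarAlgebra.spectralOrderedRing in
theorem norm_le_one_of_sum_mul_star_eq_one {D ι : Type*} [CStarAlgebra D] [Fintype ι] {b : ι → D}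
    (hb : ∑ i, b i * star (b i) = 1) (i : ι) : ‖b i‖ ≤ 1 := by
  have h : b i * star (b i) ≤ 1 := by
    rw [← hb]
    exact Finset.single_le_sum (f := fun i => b i * star (b i))
      (fun j _ => mul_star_self_nonneg (b j)) (Finset.mem_univ i)
  rw [← CStarAlgebra.norm_le_one_iff_of_nonneg _ (mul_star_self_nonneg (b i)),
    CStarRing.norm_self_mul_star, ← sq] at h
  exact (sq_le_one_iff₀ (norm_nonneg _)).1 h

variable [PartialOrder A] [StarOrderedRing A]

/-- The completely positive map `x ↦ b x b*`. -/
noncomputable def compressCP (b : 𝓜(ℂ, A)) : A →CP A :=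
  ⟨((star b).snd : A →ₗ[ℂ] A) ∘ₗ (b.fst : A →ₗ[ℂ] A), fun k M hM => by
    obtain ⟨S, rfl⟩ := exists_eq_star_mul_self hM
    let T : CStarMatrix (Fin k) (Fin k) A := ofMatrix fun p q => (star b).snd (S p q)
    refine (star_mul_self_nonneg T).trans_eq ?_
    ext p q
    rw [star_mul_self_apply, map_apply, star_mul_self_apply, map_sum]
    exact Finset.sum_congr rfl fun r _ => (compress_star_mul b (S r p) (S r q)).symm⟩

end Compress

end CompletelyPositive

/-! ### Nuclear approximations -/

section NuclearApproximation

attribute [local instance] CStarAlgebra.spectralOrder CStarAlgebra.spectralOrderedRing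

/-- The identity of `A` is approximated on `𝓕` up to `ε` by completely positive maps through a
finite-dimensional C*-algebra with summands indexed by `ι`, as in the definition of the nuclear
dimension. -/
def HasNuclearApprox (A : Type*) [NonUnitalCStarAlgebra A] (ι : Type) [Fintype ι] [DecidableEq ι]
    (𝓕 : Finset A) (ε : ℝ) : Prop :=
  ∃ (F : ι → Type) (_ : ∀ i, CStarAlgebra (F i)) (_ : ∀ i, FiniteDimensional ℂ (F i))
    (ψ : A →CP (∀ i, F i)) (φ : (∀ i, F i) →CP A),
    (∀ a, ‖ψ a‖ ≤ ‖a‖) ∧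
    (∀ i, (∀ x : F i, ‖φ (Pi.single i x)‖ ≤ ‖x‖) ∧
      IsOrderZero fun x : F i => φ (Pi.single i x)) ∧
    ∀ a ∈ 𝓕, ‖φ (ψ a) - a‖ < ε

theorem nuclearDimLE_iff {A : Type*} [NonUnitalCStarAlgebra A] {d : ℕ} :
    NuclearDimLE A d ↔
      ∀ (𝓕 : Finset A) (ε : ℝ), 0 < ε → HasNuclearApprox A (Fin (d + 1)) 𝓕 ε := Iff.rfl

section Reindex

variable {ι : Type} {F : ι → Type} [∀ i, CStarAlgebra (F i)]

/-- The identification of two summands with equal indices. -/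
noncomputable def castHom {i j : ι} (h : i = j) : F i →⋆ₙₐ[ℂ] F j :=
  h ▸ NonUnitalStarAlgHom.id ℂ (F i)

theorem castHom_apply {i j : ι} (h : i = j) (x : ∀ i, F i) : castHom h (x i) = x j := by
  subst h; rfl

/-- Reindexing along a split surjection `e`: each summand is repeated, and the second map ignores
all copies but one. -/
theorem HasNuclearApprox.of_leftInverse {A : Type*} [NonUnitalCStarAlgebra A] {κ : Type}
    [Fintype ι] [DecidableEq ι] [Fintype κ] [DecidableEq κ] {e : κ → ι} {s : ι → κ}
    (hs : Function.LeftInverse e s) {𝓕 : Finset A} {ε : ℝ} (h : HasNuclearApprox A ι 𝓕 ε) :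
    HasNuclearApprox A κ 𝓕 ε := by
  obtain ⟨F, _, _, ψ, φ, hψ, hφ, happ⟩ := h
  let ev (i : ι) : (∀ i, F i) →⋆ₙₐ[ℂ] F i :=
    { toFun x := x i, map_smul' _ _ := rfl, map_zero' := rfl, map_add' _ _ := rfl,
      map_mul' _ _ := rfl, map_star' _ := rfl }
  let ρ : (∀ k, F (e k)) →⋆ₙₐ[ℂ] ∀ i, F i :=
    { toFun x i := castHom (hs i) (x (s i))
      map_smul' c x := funext fun i => map_smul (castHom (hs i)) c (x (s i))
      map_zero' := funext fun i => map_zero (castHom (hs i))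
      map_add' x y := funext fun i => map_add (castHom (hs i)) (x (s i)) (y (s i))
      map_mul' x y := funext fun i => map_mul (castHom (hs i)) (x (s i)) (y (s i))
      map_star' x := funext fun i => map_star (castHom (hs i)) (x (s i)) }
  have hρ : ∀ x i, ρ x i = castHom (hs i) (x (s i)) := fun _ _ => rfl
  let ψ' : A →CP ∀ k, F (e k) :=
    CompletelyPositiveMap.pi fun k => (CompletelyPositiveMap.ofHom (ev (e k))).comp ψ
  have hψ' : ∀ a k, ψ' a k = ψ a (e k) := fun _ _ => rfl
  have hsingle : ∀ k (x : F (e k)), ρ (Pi.single k x) = if k = s (e k) then Pi.single (e k) x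
      else 0 := by
    intro k x
    refine funext fun i => ?_
    rw [hρ]
    by_cases hi : s i = k
    · subst hi
      rw [if_pos (by rw [hs i]), Pi.single_eq_same]
      have h := castHom_apply (hs i) (Pi.single (e (s i)) x)
      rwa [Pi.single_eq_same] at h
    · rw [Pi.single_eq_of_ne hi, map_zero]
      split_ifs with hk
      · rw [Pi.single_eq_of_ne]
        rintro rfl
        exact hi hk.symm
      · rfl
  refine ⟨fun k => F (e k), inferInstance, inferInstance, ψ', φ.comp (.ofHom ρ), fun a => ?_,
    fun k => ⟨fun x => ?_, fun x y hx hy hxy => ?_⟩, fun a ha => ?_⟩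
  · exact (pi_norm_le_iff_of_nonneg (norm_nonneg a)).2 fun k =>
      (norm_le_pi_norm (ψ a) (e k)).trans (hψ a)
  · change ‖φ (ρ (Pi.single k x))‖ ≤ ‖x‖
    rw [hsingle]
    split_ifs
    · exact (hφ (e k)).1 x
    · simp
  · change φ (ρ (Pi.single k x)) * φ (ρ (Pi.single k y)) = 0
    rw [hsingle, hsingle]
    split_ifs
    · exact (hφ (e k)).2 x y hx hy hxy
    · simp
  · have h : ρ (ψ' a) = ψ a := funext fun i => castHom_apply (hs i) (ψ a)
    change ‖φ (ρ (ψ' a)) - a‖ < ε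
    rw [h]
    exact happ a ha

end Reindex

/-- Among linear maps with a common norm bound `K`, being close to the identity at `a` can be tested
on finitely many elements of a set whose closed span contains `a`. -/
theorem exists_approx_of_mem_closure_span {A : Type*} [NormedAddCommGroup A] [NormedSpace ℂ A]
    (X : Set A) (K : ℝ) (a : A) (ha : a ∈ closure (Submodule.span ℂ X : Set A)) (ε : ℝ)
    (hε : 0 < ε) :
    ∃ (𝓖 : Finset A) (δ : ℝ), (𝓖 : Set A) ⊆ X ∧ 0 < δ ∧ ∀ T : A →ₗ[ℂ] A,
      (∀ x, ‖T x‖ ≤ K * ‖x‖) → (∀ x ∈ 𝓖, ‖T x - x‖ < δ) → ‖T a - a‖ < ε := by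
  classical
  have hspan : ∀ a ∈ Submodule.span ℂ X, ∀ ε : ℝ, 0 < ε → ∃ (𝓖 : Finset A) (δ : ℝ),
      (𝓖 : Set A) ⊆ X ∧ 0 < δ ∧ ∀ T : A →ₗ[ℂ] A, (∀ x ∈ 𝓖, ‖T x - x‖ < δ) → ‖T a - a‖ < ε := by
    intro a ha
    induction ha using Submodule.span_induction with
    | mem x hx => exact fun ε hε => ⟨{x}, ε, by simpa using hx, hε, fun T h => h x (by simp)⟩
    | zero => exact fun ε hε => ⟨∅, 1, by simp, one_pos, fun T _ => by simpa using hε⟩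
    | add x y _ _ ihx ihy =>
      intro ε hε
      obtain ⟨𝓖₁, δ₁, h₁, hδ₁, hT₁⟩ := ihx (ε / 2) (half_pos hε)
      obtain ⟨𝓖₂, δ₂, h₂, hδ₂, hT₂⟩ := ihy (ε / 2) (half_pos hε)
      refine ⟨𝓖₁ ∪ 𝓖₂, min δ₁ δ₂, by simp [h₁, h₂], lt_min hδ₁ hδ₂, fun T hT => ?_⟩
      have e₁ := hT₁ T fun z hz => (hT z (Finset.mem_union_left _ hz)).trans_le (min_le_left _ _)
      have e₂ := hT₂ T fun z hz => (hT z (Finset.mem_union_right _ hz)).trans_le (min_le_right _ _)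
      rw [map_add, add_sub_add_comm]
      linarith [norm_add_le (T x - x) (T y - y)]
    | smul c x _ ih =>
      intro ε hε
      have hc : 0 < ‖c‖ + 1 := by positivity
      obtain ⟨𝓖, δ, h, hδ, hT⟩ := ih (ε / (‖c‖ + 1)) (by positivity)
      refine ⟨𝓖, δ, h, hδ, fun T h => ?_⟩
      have e := hT T h
      rw [lt_div_iff₀ hc] at e
      rw [map_smul, ← smul_sub, norm_smul]
      nlinarith [norm_nonneg (T x - x)]
  have hη : 0 < ε / (2 * (|K| + 1)) := by positivity
  obtain ⟨a', ha', hd⟩ := Metric.mem_closure_iff.1 ha _ hη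
  obtain ⟨𝓖, δ, h, hδ, hT⟩ := hspan a' ha' (ε / 2) (half_pos hε)
  refine ⟨𝓖, δ, h, hδ, fun T hK hx => ?_⟩
  have e₁ := hT T hx
  have e₂ : ‖T (a - a')‖ ≤ |K| * ‖a - a'‖ :=
    (hK _).trans (mul_le_mul_of_nonneg_right (le_abs_self K) (norm_nonneg _))
  rw [dist_eq_norm, lt_div_iff₀ (by positivity)] at hd
  have e₃ : T a - a = T (a - a') + (T a' - a') - (a - a') := by rw [map_sub]; abel
  rw [e₃]
  linarith [norm_sub_le (T (a - a') + (T a' - a')) (a - a'),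
    norm_add_le (T (a - a')) (T a' - a')]

section Combine

variable {A : Type u} [NonUnitalCStarAlgebra A]

/-- A C*-subalgebra `B` of finite nuclear dimension is approximated by completely positive maps
that are defined on the ambient algebra: the maps `B → F` extend by Arveson's theorem. -/
theorem NuclearDimLE.exists_approx_of_injective {B : Type u} [NonUnitalCStarAlgebra B]
    (j : B →⋆ₙₐ[ℂ] A) (hj : Function.Injective j) {m : ℕ} (hB : NuclearDimLE B m)
    (𝓖 : Finset A) (h𝓖 : ∀ x ∈ 𝓖, x ∈ Set.range j) {ε : ℝ} (hε : 0 < ε) :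
    HasNuclearApprox A (Fin (m + 1)) 𝓖 ε := by
  classical
  choose! f hf using h𝓖
  obtain ⟨F, _, _, ψ, φ, hψ, hφ, hφψ⟩ := hB (𝓖.image f) ε hε
  obtain ⟨θ, hθ, hθn⟩ := exists_contractive_completelyPositive_extension j hj ψ hψ
  refine ⟨F, inferInstance, inferInstance, θ, (CompletelyPositiveMap.ofHom j).comp φ, hθn,
    fun i => ⟨fun x => ?_, fun x y hx hy hxy => ?_⟩, fun a ha => ?_⟩
  · change ‖j (φ (Pi.single i x))‖ ≤ ‖x‖
    rw [NonUnitalStarAlgHom.norm_map j hj]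
    exact (hφ i).1 x
  · change j (φ (Pi.single i x)) * j (φ (Pi.single i y)) = 0
    rw [← map_mul, (hφ i).2 x y hx hy hxy, map_zero]
  · change ‖j (φ (θ a)) - a‖ < ε
    have h := hφψ (f a) (Finset.mem_image_of_mem f ha)
    rw [← hf a ha, hθ, ← map_sub, NonUnitalStarAlgHom.norm_map j hj]
    exact h

/-- Approximations of the compressions `b i x (b i)*`, one for each `i`, add up to an approximation
of the identity. -/
theorem HasNuclearApprox.sigma {d : ℕ} {m : Fin (d + 1) → ℕ}
    {b : Fin (d + 1) → 𝓜(ℂ, A)} (hb : ∑ i, b i * star (b i) = 1) {𝓕 : Finset A} {ε : ℝ}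
    (h : ∀ i, ∃ 𝓖 : Finset A, (∀ x ∈ 𝓕, compress (b i) x ∈ 𝓖) ∧
      HasNuclearApprox A (Fin (m i + 1)) 𝓖 (ε / (d + 1)))
    (happ : ∀ x ∈ 𝓕, ‖x - ∑ i, compress (b i) x‖ < ε) :
    HasNuclearApprox A (Σ i, Fin (m i + 1)) 𝓕 (2 * ε) := by
  choose 𝓖 h𝓖 F hF hFd θ φ hθ hφ hφθ using h
  let ev (i) (k) : (∀ k, F i k) →⋆ₙₐ[ℂ] F i k :=
    { toFun x := x k, map_smul' _ _ := rfl, map_zero' := rfl, map_add' _ _ := rfl,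
      map_mul' _ _ := rfl, map_star' _ := rfl }
  let res (i) : (∀ p : Σ i, Fin (m i + 1), F p.1 p.2) →⋆ₙₐ[ℂ] ∀ k, F i k :=
    { toFun x k := x ⟨i, k⟩, map_smul' _ _ := rfl, map_zero' := rfl, map_add' _ _ := rfl,
      map_mul' _ _ := rfl, map_star' _ := rfl }
  let Ψ : A →CP ∀ p : Σ i, Fin (m i + 1), F p.1 p.2 := CompletelyPositiveMap.pi fun p =>
    (CompletelyPositiveMap.ofHom (ev p.1 p.2)).comp ((θ p.1).comp (compressCP (b p.1)))
  let Φ : (∀ p : Σ i, Fin (m i + 1), F p.1 p.2) →CP A := CompletelyPositiveMap.sum fun i =>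
    (φ i).comp (CompletelyPositiveMap.ofHom (res i))
  have hΨ : ∀ a p, Ψ a p = θ p.1 (compress (b p.1) a) p.2 := fun _ _ => rfl
  have hΦ : ∀ x, Φ x = ∑ i, φ i (res i x) := fun x => CompletelyPositiveMap.sum_apply _ _
  have hΦs : ∀ p (x : F p.1 p.2), Φ (Pi.single p x) = φ p.1 (Pi.single p.2 x) := by
    rintro ⟨i, k⟩ x
    rw [hΦ, Finset.sum_eq_single i (fun j _ hj => ?_) (by simp)]
    · congr 2
      refine funext fun l => ?_
      change Pi.single (M := fun p : Σ i, Fin (m i + 1) => F p.1 p.2) ⟨i, k⟩ x ⟨i, l⟩ = _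
      by_cases hl : l = k
      · subst hl
        simp
      · rw [Pi.single_eq_of_ne (by simpa using hl), Pi.single_eq_of_ne hl]
    · have h0 : res j (Pi.single ⟨i, k⟩ x) = 0 := funext fun l =>
        Pi.single_eq_of_ne (M := fun p : Σ i, Fin (m i + 1) => F p.1 p.2)
          (fun h => hj (congrArg Sigma.fst h)) x
      change φ j (res j (Pi.single ⟨i, k⟩ x)) = 0
      rw [h0, map_zero]
  refine ⟨fun p => F p.1 p.2, inferInstance, inferInstance, Ψ, Φ, fun a => ?_,
    fun p => ⟨fun x => ?_, fun x y hx hy hxy => ?_⟩, fun x hx => ?_⟩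
  · refine (pi_norm_le_iff_of_nonneg (norm_nonneg a)).2 fun p => ?_
    rw [hΨ]
    exact (norm_le_pi_norm _ p.2).trans <| (hθ _ _).trans <|
      norm_compress_le (norm_le_one_of_sum_mul_star_eq_one hb p.1) a
  · rw [hΦs]
    exact (hφ p.1 p.2).1 x
  · change Φ (Pi.single p x) * Φ (Pi.single p y) = 0
    rw [hΦs, hΦs]
    exact (hφ p.1 p.2).2 x y hx hy hxy
  · have h1 : Φ (Ψ x) = ∑ i, φ i (θ i (compress (b i) x)) := by
      rw [hΦ]
      rfl
    have h2 : ∀ i, ‖φ i (θ i (compress (b i) x)) - compress (b i) x‖ ≤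
        ε / (d + 1) := fun i =>
      (hφθ i _ (h𝓖 i x hx)).le
    have h3 : ‖∑ i, (φ i (θ i (compress (b i) x)) - compress (b i) x)‖ ≤ ε := by
      refine (norm_sum_le_of_le _ fun i _ => h2 i).trans_eq ?_
      rw [Finset.sum_const, Finset.card_univ, Fintype.card_fin, nsmul_eq_mul]
      push_cast
      field_simp
    have h4 := happ x hx
    rw [norm_sub_rev] at h4
    have h5 : Φ (Ψ x) - x =
        ∑ i, (φ i (θ i (compress (b i) x)) - compress (b i) x) +
          (∑ i, compress (b i) x - x) := by
      rw [h1, Finset.sum_sub_distrib]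
      abel
    rw [h5]
    linarith [norm_add_le (∑ i, (φ i (θ i (compress (b i) x)) -
      compress (b i) x)) (∑ i, compress (b i) x - x)]

end Combine

end NuclearApproximation

/-! ### The bound on the nuclear dimension -/

section NuclearDimensionBound

attribute [local instance] CStarAlgebra.spectralOrder CStarAlgebra.spectralOrderedRing

/-- The two maps of a nuclear approximation compose to a linear map of norm at most the number of
summands, as each summand contributes a contraction. Hence the set of approximated elements can be
changed if closeness to the identity transfers for maps with that bound. -/
theorem HasNuclearApprox.of_forall_linearMap {A : Type*} [NonUnitalCStarAlgebra A] {ι : Type}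
    [Fintype ι] [DecidableEq ι] {𝓕 𝓖 : Finset A} {δ ε : ℝ} (h : HasNuclearApprox A ι 𝓖 δ)
    (hT : ∀ T : A →ₗ[ℂ] A, (∀ x, ‖T x‖ ≤ Fintype.card ι * ‖x‖) →
      (∀ x ∈ 𝓖, ‖T x - x‖ < δ) → ∀ x ∈ 𝓕, ‖T x - x‖ < ε) : HasNuclearApprox A ι 𝓕 ε := by
  obtain ⟨F, _, _, ψ, φ, hψ, hφ, happ⟩ := h
  refine ⟨F, inferInstance, inferInstance, ψ, φ, hψ, hφ,
    hT ((φ : (∀ i, F i) →ₗ[ℂ] A) ∘ₗ (ψ : A →ₗ[ℂ] ∀ i, F i)) (fun x => ?_) happ⟩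
  change ‖φ (ψ x)‖ ≤ _
  rw [← Finset.univ_sum_single (ψ x), map_sum]
  refine (norm_sum_le_of_le _ fun i _ =>
    ((hφ i).1 _).trans ((norm_le_pi_norm (ψ x) i).trans (hψ x))).trans_eq ?_
  rw [Finset.sum_const, Finset.card_univ, nsmul_eq_mul]

/-- The number of summands, hence the norm bound, does not depend on the approximation, so it is
enough to approximate finite subsets of a set with dense span. -/
theorem hasNuclearApprox_of_dense_span {A : Type*} [NonUnitalCStarAlgebra A] {ι : Type}
    [Fintype ι] [DecidableEq ι] {X : Set A} (hX : Dense (Submodule.span ℂ X : Set A))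
    (h : ∀ 𝓖 : Finset A, (𝓖 : Set A) ⊆ X → ∀ δ : ℝ, 0 < δ → HasNuclearApprox A ι 𝓖 δ)
    (𝓕 : Finset A) {ε : ℝ} (hε : 0 < ε) : HasNuclearApprox A ι 𝓕 ε := by
  classical
  choose 𝓖 δ h𝓖 hδ hT using fun a =>
    exists_approx_of_mem_closure_span X (Fintype.card ι) a (hX a) ε hε
  obtain ⟨η, hη, hηδ⟩ : ∃ η > 0, ∀ a ∈ 𝓕, η ≤ δ a := by
    rcases 𝓕.eq_empty_or_nonempty with rfl | hne
    · exact ⟨1, one_pos, by simp⟩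
    · exact ⟨𝓕.inf' hne δ, (Finset.lt_inf'_iff hne).2 fun a _ => hδ a,
        fun a ha => Finset.inf'_le δ ha⟩
  refine (h (𝓕.biUnion 𝓖) (by simpa using fun a _ => h𝓖 a) η hη).of_forall_linearMap
    fun T hTn hTx a ha => hT a T hTn fun x hx => ?_
  exact (hTx x (Finset.mem_biUnion.2 ⟨a, ha, hx⟩)).trans_le (hηδ a ha)

theorem exists_nuclearDimLE_of_nuclearDim_le {A : Type*} [NonUnitalCStarAlgebra A] {n : ℕ}
    (h : nuclearDim A ≤ n) : ∃ m ≤ n, NuclearDimLE A m := by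
  have hne : {x : ℕ∞ | ∃ d : ℕ, x = d ∧ NuclearDimLE A d}.Nonempty := by
    by_contra hne
    rw [Set.not_nonempty_iff_eq_empty] at hne
    rw [nuclearDim, hne, sInf_empty, top_le_iff] at h
    exact ENat.natCast_ne_top n h
  obtain ⟨m, hm, hA⟩ := csInf_mem hne
  refine ⟨m, ?_, hA⟩
  rw [← Nat.cast_le (α := ℕ∞), ← hm]
  exact h

/-- Compressions into subalgebras of nuclear dimension at most `n` that approximate the identity
on a set of dense span bound the nuclear dimension, whatever the compressing multipliers are. -/
theorem nuclearDim_add_one_le {A : Type u} [NonUnitalCStarAlgebra A] {X : Set A}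
    (hX : Dense (Submodule.span ℂ X : Set A)) {d n : ℕ}
    (h : ∀ 𝓕 : Finset A, (𝓕 : Set A) ⊆ X → ∀ ε : ℝ, 0 < ε →
      ∃ (B : Fin (d + 1) → NonUnitalStarSubalgebra ℂ A) (_ : ∀ i, IsClosed (B i : Set A))
        (b : Fin (d + 1) → 𝓜(ℂ, A)), ∑ i, b i * star (b i) = 1 ∧
        (∀ i, nuclearDim (B i) ≤ n) ∧ (∀ i, ∀ x ∈ 𝓕, compress (b i) x ∈ B i) ∧
        ∀ x ∈ 𝓕, ‖x - ∑ i, compress (b i) x‖ < ε) :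
    nuclearDim A + 1 ≤ (d + 1) * ((n : ℕ∞) + 1) := by
  classical
  -- The summands over all `i` are at most `(d + 1) * (n + 1)` in number.
  obtain ⟨N, hN⟩ : ∃ N, N + 1 = (d + 1) * (n + 1) := ⟨_, Nat.succ_pred (by positivity)⟩
  have hA : NuclearDimLE A N := by
    refine nuclearDimLE_iff.2 fun 𝓕 ε hε => hasNuclearApprox_of_dense_span hX ?_ 𝓕 hε
    intro 𝓖 h𝓖 δ hδ
    obtain ⟨B, hB, b, hb, hn, hbB, happ⟩ := h 𝓖 h𝓖 (δ / 2) (half_pos hδ)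
    choose m hmn hm using fun i => exists_nuclearDimLE_of_nuclearDim_le (hn i)
    have happ' : HasNuclearApprox A (Σ i, Fin (m i + 1)) 𝓖 (2 * (δ / 2)) := by
      refine HasNuclearApprox.sigma hb (fun i => ⟨𝓖.image (compress (b i)),
        fun x hx => Finset.mem_image_of_mem _ hx,
        (hm i).exists_approx_of_injective (NonUnitalStarSubalgebraClass.subtype (B i))
          Subtype.val_injective _ (fun y hy => ?_) (by positivity)⟩) happ
      obtain ⟨x, hx, rfl⟩ := Finset.mem_image.1 hy
      exact ⟨⟨_, hbB i x hx⟩, rfl⟩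
    rw [mul_div_cancel₀ δ two_ne_zero] at happ'
    have hcard : Fintype.card (Σ i, Fin (m i + 1)) ≤ Fintype.card (Fin (N + 1)) := by
      rw [Fintype.card_sigma, Fintype.card_fin, hN]
      calc ∑ i, Fintype.card (Fin (m i + 1)) ≤ ∑ _i : Fin (d + 1), (n + 1) :=
            Finset.sum_le_sum fun i _ => by simpa using hmn i
        _ = (d + 1) * (n + 1) := by simp
    obtain ⟨s⟩ := Function.Embedding.nonempty_of_card_le hcard
    have : Nonempty (Σ i, Fin (m i + 1)) := ⟨⟨0, 0⟩⟩
    exact happ'.of_leftInverse (Function.leftInverse_invFun s.injective)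
  calc nuclearDim A + 1 ≤ (N : ℕ∞) + 1 := by
        gcongr
        exact sInf_le ⟨N, rfl, hA⟩
    _ = (d + 1) * ((n : ℕ∞) + 1) := by exact_mod_cast hN

end NuclearDimensionBound

theorem mainTheorem12 {A : Type u} [NonUnitalCStarAlgebra A]
    (hA : ¬ ∃ e : A, ∀ a : A, e * a = a ∧ a * e = a)
    (X : Set A) (hX : Dense (Submodule.span ℂ X : Set A))
    (M : StarSubalgebra ℂ 𝓜(ℂ, A)) (hM : IsClosed (M : Set 𝓜(ℂ, A)))
    (hMcomm : ∀ a ∈ M, ∀ b ∈ M, a * b = b * a) (d n : ℕ) :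
    ((∀ 𝓕 : Finset A, (𝓕 : Set A) ⊆ X → ∀ ε : ℝ, 0 < ε →
        ∃ (B : Fin (d + 1) → NonUnitalStarSubalgebra ℂ A) (_ : ∀ i, IsClosed (B i : Set A))
          (b : Fin (d + 1) → 𝓜(ℂ, A)),
          (∀ i, b i ∈ M) ∧ ∑ i, b i * star (b i) = 1 ∧
          (∀ i, nuclearDim (B i) ≤ n) ∧
          (∀ i, ∀ x ∈ 𝓕, compress (b i) x ∈ B i) ∧
          ∀ x ∈ 𝓕, ‖x - ∑ i, compress (b i) x‖ < ε) →
      nuclearDim A + 1 ≤ (d + 1) * (coveringDim (WeakDual.characterSpace ℂ M) + n + 2)) ∧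
    ((∀ 𝓕 : Finset A, (𝓕 : Set A) ⊆ X → ∀ ε : ℝ, 0 < ε →
        ∃ (B : Fin (d + 1) → NonUnitalStarSubalgebra ℂ A) (_ : ∀ i, IsClosed (B i : Set A))
          (b : Fin (d + 1) → 𝓜(ℂ, A)),
          (∀ i, b i ∈ M) ∧ ∑ i, b i * star (b i) = 1 ∧
          (∀ i, nuclearDim (B i) ≤ n) ∧
          (∀ i, TopologicalSpace.SeparableSpace (B i) ∧ IsSubhomogeneous (B i)) ∧
          (∀ i, ∀ x ∈ 𝓕, compress (b i) x ∈ B i) ∧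
          ∀ x ∈ 𝓕, ‖x - ∑ i, compress (b i) x‖ < ε) →
      nuclearDim A + 1 ≤
        (d + 1) * (max (n : ℕ∞) (coveringDim (WeakDual.characterSpace ℂ M)) + 1)) := by
  refine ⟨fun h => (nuclearDim_add_one_le (d := d) (n := n) hX fun 𝓕 h𝓕 ε hε => ?_).trans ?_,
    fun h => (nuclearDim_add_one_le (d := d) (n := n) hX fun 𝓕 h𝓕 ε hε => ?_).trans ?_⟩
  · obtain ⟨B, hB, b, -, hb, hn, hbB, happ⟩ := h 𝓕 h𝓕 ε hε
    exact ⟨B, hB, b, hb, hn, hbB, happ⟩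
  · refine mul_le_mul_right ?_ _
    calc (n : ℕ∞) + 1 ≤ n + 2 := by gcongr; norm_num
      _ ≤ coveringDim (WeakDual.characterSpace ℂ M) + n + 2 := by
        rw [add_assoc]
        exact le_add_self
  · obtain ⟨B, hB, b, -, hb, hn, -, hbB, happ⟩ := h 𝓕 h𝓕 ε hε
    exact ⟨B, hB, b, hb, hn, hbB, happ⟩
  · refine mul_le_mul_right ?_ _
    gcongr
    exact le_max_left _ _
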